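/- Let $N\ge 1$ be an integer, let $k\in\mathbb{N}$, let $\Omega\subset\mathbb{R}^N$ be a bounded domain (open and connected) and let $a\in(0,|\Omega|)$. For $\eta\in(0,1]$ let $$f_\eta(s)=\begin{cases}\frac1\eta (s-a) & \text{if } s\ge a,\\ \eta(s-a) & \text{if } s\le a.\end{cases}$$ For a function $u$ on $\Omega$ put $\Omega_u=\{x\in\Omega : u(x)\ne 0\}$, let $$\overline H=\{(u_1,\dots,u_k)\in H^1_0(\Omega;\mathbb{R}^k) : u_i\ne 0 \text{ for every } i,\ u_iu_j= 0 \text{ a.e. in }\Omega\text{ for } i\ne j\},$$ and for $(u_1,\dots,u_k)\in\overline H$ let $$J_\eta(u_1,\dots,u_k)=\sum_{i=1}^k\frac{\int_\Omega|\nabla u_i|^2}{\int_\Omega u_i^2}+f_\eta\Big(\sum_{i=1}^k|\Omega_{u_i}|\Big).$$ Let $\operatorname{Per}(E)=\sup\{\int_E \operatorname{div}\phi\,dx : \phi\in C^1_c(\mathbb{R}^N;\mathbb{R}^N),\ \|\phi\|_\infty\le 1\}$ be the De Giorgi perimeter. Then there is a constant $C>0$, depending only on $N,k,a,\Omega$,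 such that for every $\eta\in(0,1]$ and every minimizer $(u_1,\dots,u_k)$ of $J_\eta$ over $\overline H$ with $\int_\Omega u_i^2=1$ for all $i$, each set $\Omega_{u_i}$ has finite perimeter and $$\operatorname{Per}(\Omega_{u_i})\le C\,\eta^{-1/2}\qquad\text{for every } i=1,\dots,k.$$ -/

import Mathlib

open MeasureTheory Filter Topology
open scoped ENNReal ContDiff

noncomputable section

namespace SpectralPartition

/-- `ℝ^N` with the Euclidean norm and Lebesgue measure. -/
abbrev Space (N : ℕ) : Type := EuclideanSpace ℝ (Fin N)

/-- `φ ∈ C_c^∞(Ω)`. -/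
def IsTestFunction {N : ℕ} (Ω : Set (Space N)) (φ : Space N → ℝ) : Prop :=
  ContDiff ℝ ∞ φ ∧ HasCompactSupport φ ∧ tsupport φ ⊆ Ω

/-- `G` is a weak (distributional) gradient of `u` in `Ω`. A function on `Ω` is represented by a
function on the whole space, of which only the values in `Ω` are used. -/
def IsWeakGradient {N : ℕ} (Ω : Set (Space N)) (u : Space N → ℝ) (G : Space N → Space N) : Prop :=
  LocallyIntegrableOn u Ω ∧ LocallyIntegrableOn G Ω ∧
    ∀ φ : Space N → ℝ, IsTestFunction Ω φ → ∀ v : Space N,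
      ∫ x in Ω, u x * fderiv ℝ φ x v = - ∫ x in Ω, inner ℝ (G x) v * φ x

open Classical in
/-- The weak gradient `∇u` in `Ω` (determined almost everywhere in `Ω` when it exists). -/
def weakGradient {N : ℕ} (Ω : Set (Space N)) (u : Space N → ℝ) : Space N → Space N :=
  if h : ∃ G, IsWeakGradient Ω u G then h.choose else 0

/-- `u ∈ H^1_0(Ω)`: `u` belongs to `H^1(Ω)` and is the limit of functions of `C_c^∞(Ω)` in the
`H^1(Ω)` norm. -/
def MemH10 {N : ℕ} (Ω : Set (Space N)) (u : Space N → ℝ) : Prop :=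
  MemLp u 2 (volume.restrict Ω) ∧
    ∃ G : Space N → Space N, IsWeakGradient Ω u G ∧ MemLp G 2 (volume.restrict Ω) ∧
      ∃ φ : ℕ → Space N → ℝ, (∀ n, IsTestFunction Ω (φ n)) ∧
        Tendsto (fun n => eLpNorm (fun x => φ n x - u x) 2 (volume.restrict Ω)) atTop (𝓝 0) ∧
        Tendsto (fun n => eLpNorm (fun x => gradient (φ n) x - G x) 2 (volume.restrict Ω))
          atTop (𝓝 0)

/-- `Ω_u = {x ∈ Ω : u(x) ≠ 0}`. -/
def nodalSet {N : ℕ} (Ω : Set (Space N)) (u : Space N → ℝ) : Set (Space N) :=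
  {x | x ∈ Ω ∧ u x ≠ 0}

/-- The penalization `f_η`. -/
def penalty (a η s : ℝ) : ℝ :=
  if a ≤ s then (1 / η) * (s - a) else η * (s - a)

/-- The class `H̄` of vectors in `H^1_0(Ω; ℝ^k)` with nonzero, mutually segregated components. -/
def admissible {N : ℕ} (Ω : Set (Space N)) (k : ℕ) : Set (Fin k → Space N → ℝ) :=
  {u | (∀ i, MemH10 Ω (u i)) ∧
    (∀ i, ¬ (u i =ᵐ[volume.restrict Ω] 0)) ∧
    ∀ i j, i ≠ j → ∀ᵐ x ∂(volume.restrict Ω), u i x * u j x = 0}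

/-- The penalized functional `J_η`. -/
def functionalJ {N : ℕ} (Ω : Set (Space N)) (k : ℕ) (a η : ℝ) (u : Fin k → Space N → ℝ) : ℝ :=
  ∑ i, (∫ x in Ω, ‖weakGradient Ω (u i) x‖ ^ 2) / (∫ x in Ω, (u i x) ^ 2) +
    penalty a η (∑ i, volume.real (nodalSet Ω (u i)))

/-- `u` minimizes `J_η` over `H̄`, and every component has unit norm in `L²(Ω)`. -/
def IsNormalizedMinimizer {N : ℕ} (Ω : Set (Space N)) (k : ℕ) (a η : ℝ)
    (u : Fin k → Space N → ℝ) : Prop :=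
  u ∈ admissible Ω k ∧ IsMinOn (functionalJ Ω k a η) (admissible Ω k) u ∧
    ∀ i, ∫ x in Ω, (u i x) ^ 2 = 1

/-- The divergence of a vector field on `ℝ^N`. -/
def divergence {N : ℕ} (φ : Space N → Space N) (x : Space N) : ℝ :=
  ∑ i, (fderiv ℝ φ x (EuclideanSpace.single i 1)) i

/-- The De Giorgi perimeter of `E` in `ℝ^N`: the supremum of `∫_E div φ` over
`φ ∈ C^1_c(ℝ^N; ℝ^N)` with `‖φ‖_∞ ≤ 1`. (The family contains `0`, so that truncating its members
at `0` does not change the supremum.) -/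
def perimeter {N : ℕ} (E : Set (Space N)) : ℝ≥0∞ :=
  ⨆ φ ∈ {φ : Space N → Space N | ContDiff ℝ 1 φ ∧ HasCompactSupport φ ∧ ∀ x, ‖φ x‖ ≤ 1},
    ENNReal.ofReal (∫ x in E, divergence φ x)

/-- `E` has finite perimeter. -/
def HasFinitePerimeter {N : ℕ} (E : Set (Space N)) : Prop := perimeter E < ⊤

end SpectralPartition

end

noncomputable section

namespace SpectralPartition

/-! Each component `u i` is compared with `β (u i)`, where `β` is a smooth truncation vanishing on
`[-t, t]`, with `0 ≤ β' ≤ 1` and `|β s - s| ≤ 4 t`. Write `l` for the Dirichlet energy of `u i`, `D`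
for its part on `{|u i| ≤ t}`, and `μ` for the measure of the layer `{0 < |u i| ≤ t}`. Truncation
lowers the energy by at least `D` and the measure of the support by at least `μ`. It costs at most
`A t` of the unit mass, with `A = 4 (|Ω| + 1)`. Since `f_η` has slope at least `η`, minimality gives
`D + η μ (1 - A t) ≤ A t l` (`IsNormalizedMinimizer.layer_energy_le`).

For `A t ≤ 1/2` this yields `D + η μ ≤ 3 A t l`. Young's inequality with weight `√η` then bounds the
integral of `|∇u i|` over the layer by a multiple of `l t / √η`
(`IsNormalizedMinimizer.layer_integral_le`).

Such a linear bound in `t` controls the perimeter (`perimeter_nodalSet_le`): approximate the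
indicator of `{u i ≠ 0}` by `γ_t (u i)` with `|γ_t'| ≤ K / t` supported in the layer, and integrate
by parts against the vector field. The factors `t` cancel.

Finally `l` is bounded independently of `η` by testing minimality with a fixed family of disjoint
bumps of total measure at most `a` (`exists_rayleigh_bound`). -/

/-! ### Convergence tools in `L²`. -/

theorem tendsto_eLpNorm_two_zero_of_dominated {α E F : Type*} [MeasurableSpace α] {μ : Measure α}
    [NormedAddCommGroup E] [NormedAddCommGroup F] {h : ℕ → α → E} {g : α → F}
    (hm : ∀ n, AEStronglyMeasurable (h n) μ) (hg : MemLp g 2 μ)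
    (hb : ∀ n, ∀ᵐ x ∂μ, ‖h n x‖ ≤ ‖g x‖)
    (hlim : ∀ᵐ x ∂μ, Tendsto (fun n => h n x) atTop (𝓝 0)) :
    Tendsto (fun n => eLpNorm (h n) 2 μ) atTop (𝓝 0) := by
  have key : Tendsto (fun n => ∫⁻ x, ‖h n x‖ₑ ^ (2 : ℝ) ∂μ) atTop (𝓝 (∫⁻ _, 0 ∂μ)) := by
    refine tendsto_lintegral_of_dominated_convergence' (fun x => ‖g x‖ₑ ^ (2 : ℝ))
      (fun n => (hm n).enorm.pow_const _) (fun n => ?_) ?_ ?_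
    · filter_upwards [hb n] with x hx
      exact ENNReal.rpow_le_rpow (enorm_le_iff_norm_le.2 hx) (by norm_num)
    · have := lintegral_rpow_enorm_lt_top_of_eLpNorm_lt_top (p := 2) (by simp) (by simp) hg.2
      simpa using this.ne
    · filter_upwards [hlim] with x hx
      have := (ENNReal.continuous_rpow_const (y := (2 : ℝ))).tendsto 0 |>.comp
        (by simpa [Function.comp_def] using (continuous_enorm.tendsto _).comp hx :
          Tendsto (fun n => ‖h n x‖ₑ) atTop (𝓝 0))
      simpa [Function.comp_def] using this
  have := ((ENNReal.continuous_rpow_const (y := (1 / 2 : ℝ))).tendsto _).comp key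
  simpa [eLpNorm_eq_lintegral_rpow_enorm_toReal, Function.comp_def] using this

theorem tendsto_integral_inner_of_eLpNorm_two {α E : Type*} [MeasurableSpace α] {μ : Measure α}
    [IsFiniteMeasure μ] [NormedAddCommGroup E] [InnerProductSpace ℝ E]
    {f : ℕ → α → E} {F g : α → E} {C : ℝ} (hf : ∀ n, MemLp (f n) 2 μ) (hF : MemLp F 2 μ)
    (hg : AEStronglyMeasurable g μ) (hC : ∀ x, ‖g x‖ ≤ C)
    (hlim : Tendsto (fun n => eLpNorm (fun x => f n x - F x) 2 μ) atTop (𝓝 0)) :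
    Tendsto (fun n => ∫ x, inner ℝ (f n x) (g x) ∂μ) atTop (𝓝 (∫ x, inner ℝ (F x) (g x) ∂μ)) := by
  have hint : ∀ f : α → E, MemLp f 2 μ → Integrable (fun x => inner ℝ (f x) (g x)) μ := by
    intro f hf
    refine ((hf.integrable (by norm_num)).norm.const_mul C).mono' (hf.1.inner hg)
      (Eventually.of_forall fun x => ?_)
    refine (norm_inner_le_norm _ _).trans ?_
    rw [mul_comm]
    exact mul_le_mul_of_nonneg_right (hC x) (norm_nonneg _)
  refine tendsto_integral_of_L1' _ (hF.1.inner hg) (Eventually.of_forall fun n => hint _ (hf n)) ?_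
  set K := μ Set.univ ^ (1 / (1 : ℝ≥0∞).toReal - 1 / (2 : ℝ≥0∞).toReal) with hK
  have hKfin : K ≠ ⊤ := ENNReal.rpow_ne_top_of_nonneg (by norm_num) (measure_ne_top _ _)
  have hub : Tendsto (fun n => ENNReal.ofReal C * (eLpNorm (fun x => f n x - F x) 2 μ * K)) atTop
      (𝓝 0) := by
    have := ENNReal.Tendsto.const_mul (a := ENNReal.ofReal C)
      (ENNReal.Tendsto.mul_const (b := K) hlim (Or.inr hKfin)) (Or.inr ENNReal.ofReal_ne_top)
    simpa using this
  refine tendsto_of_tendsto_of_tendsto_of_le_of_le tendsto_const_nhds hub (fun _ => zero_le)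
    (fun n => ?_)
  refine (eLpNorm_le_mul_eLpNorm_of_ae_le_mul (g := fun x => f n x - F x) (c := C)
    (Eventually.of_forall fun x => ?_) 1).trans ?_
  · simp only [Pi.sub_apply, ← inner_sub_left]
    refine (norm_inner_le_norm _ _).trans ?_
    rw [mul_comm]
    exact mul_le_mul_of_nonneg_right (hC x) (norm_nonneg _)
  · gcongr
    exact eLpNorm_le_eLpNorm_mul_rpow_measure_univ (by norm_num) ((hf n).1.sub hF.1)

/-! ### Calculus in `H^1_0`: integration by parts, uniqueness of the gradient, chain rule. -/

variable {N : ℕ} {Ω : Set (Space N)} {u : Space N → ℝ} {G : Space N → Space N}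

/-- `u ∈ H^1_0(Ω)` with gradient `G`, as a limit of test functions. -/
def HasH10Gradient (Ω : Set (Space N)) (u : Space N → ℝ) (G : Space N → Space N) : Prop :=
  MemLp u 2 (volume.restrict Ω) ∧ MemLp G 2 (volume.restrict Ω) ∧
    ∃ φ : ℕ → Space N → ℝ, (∀ n, IsTestFunction Ω (φ n)) ∧
      Tendsto (fun n => eLpNorm (fun x => φ n x - u x) 2 (volume.restrict Ω)) atTop (𝓝 0) ∧
      Tendsto (fun n => eLpNorm (fun x => gradient (φ n) x - G x) 2 (volume.restrict Ω))
        atTop (𝓝 0)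

theorem continuous_gradient {φ : Space N → ℝ} (hφ : ContDiff ℝ 1 φ) : Continuous (gradient φ) :=
  (InnerProductSpace.toDual ℝ (Space N)).symm.continuous.comp (hφ.continuous_fderiv (by norm_num))

theorem gradient_eq_zero_of_notMem_tsupport {φ : Space N → ℝ} {x : Space N}
    (hx : x ∉ tsupport φ) : gradient φ x = 0 := by
  have : fderiv ℝ φ x = 0 := image_eq_zero_of_notMem_tsupport
    (fun h => hx (tsupport_fderiv_subset ℝ h))
  simp [gradient, this]

theorem IsTestFunction.memLp {φ : Space N → ℝ} (h : IsTestFunction Ω φ) (μ : Measure (Space N))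
    [IsFiniteMeasureOnCompacts μ] : MemLp φ 2 μ :=
  h.1.continuous.memLp_of_hasCompactSupport h.2.1

theorem IsTestFunction.memLp_gradient {φ : Space N → ℝ} (h : IsTestFunction Ω φ)
    (μ : Measure (Space N)) [IsFiniteMeasureOnCompacts μ] : MemLp (gradient φ) 2 μ :=
  (continuous_gradient (h.1.of_le (by norm_cast))).memLp_of_hasCompactSupport
    (h.2.1.mono' fun x hx => by
      by_contra h'
      exact hx (gradient_eq_zero_of_notMem_tsupport h'))

theorem IsTestFunction.hasH10Gradient {φ : Space N → ℝ} (h : IsTestFunction Ω φ) :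
    HasH10Gradient Ω φ (gradient φ) :=
  ⟨h.memLp _, h.memLp_gradient _, fun _ => φ, fun _ => h, by simp, by simp⟩

theorem IsTestFunction.integral_mul_fderiv {φ ψ : Space N → ℝ} (h : IsTestFunction Ω φ)
    (hψ : ContDiff ℝ 1 ψ) (v : Space N) :
    ∫ x in Ω, φ x * fderiv ℝ ψ x v = - ∫ x in Ω, inner ℝ (gradient φ x) v * ψ x := by
  have hφ1 : ContDiff ℝ 1 φ := h.1.of_le (by norm_cast)
  have hcφ := hφ1.continuous
  have hcψ := hψ.continuous
  have hc1 : Continuous fun x => fderiv ℝ φ x v :=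
    (hφ1.continuous_fderiv (by norm_num)).clm_apply continuous_const
  have hc2 : Continuous fun x => fderiv ℝ ψ x v :=
    (hψ.continuous_fderiv (by norm_num)).clm_apply continuous_const
  have hs : HasCompactSupport fun x => fderiv ℝ φ x v := h.2.1.fderiv_apply ℝ v
  simp only [inner_gradient_left]
  rw [setIntegral_eq_integral_of_forall_compl_eq_zero, setIntegral_eq_integral_of_forall_compl_eq_zero]
  · exact integral_mul_fderiv_eq_neg_fderiv_mul_of_integrable
      ((hc1.mul hcψ).integrable_of_hasCompactSupport hs.mul_right)
      ((hcφ.mul hc2).integrable_of_hasCompactSupport h.2.1.mul_right)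
      ((hcφ.mul hcψ).integrable_of_hasCompactSupport h.2.1.mul_right)
      (fun x _ => hφ1.differentiable (by norm_num) x)
      (fun x _ => hψ.differentiable (by norm_num) x)
  · intro x hx
    rw [← inner_gradient_left, gradient_eq_zero_of_notMem_tsupport fun h' => hx (h.2.2 h')]
    simp
  · intro x hx
    rw [image_eq_zero_of_notMem_tsupport fun h' => hx (h.2.2 h'), zero_mul]

/-- The support of `ψ` may cross the boundary of `Ω`: the approximating functions vanish near it, so
no boundary term appears. This is what gives access to the perimeter in all of `ℝ^N`, with no
regularity of `Ω`. -/
theorem HasH10Gradient.integral_mul_fderiv (h : HasH10Gradient Ω u G) (hfin : volume Ω ≠ ⊤)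
    {ψ : Space N → ℝ} (hψ : ContDiff ℝ 1 ψ) (hψc : HasCompactSupport ψ) (v : Space N) :
    ∫ x in Ω, u x * fderiv ℝ ψ x v = - ∫ x in Ω, inner ℝ (G x) v * ψ x := by
  have : IsFiniteMeasure (volume.restrict Ω) := ⟨by simpa using hfin.lt_top⟩
  obtain ⟨hu, hG, φ, hφ, h1, h2⟩ := h
  have hc2 : Continuous fun x => fderiv ℝ ψ x v :=
    (hψ.continuous_fderiv (by norm_num)).clm_apply continuous_const
  obtain ⟨C, hC⟩ := (hψc.fderiv_apply ℝ v).exists_bound_of_continuous hc2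
  obtain ⟨C', hC'⟩ := hψc.exists_bound_of_continuous hψ.continuous
  have l1 := tendsto_integral_inner_of_eLpNorm_two (fun n => (hφ n).memLp _) hu
    hc2.aestronglyMeasurable hC h1
  have l2 := tendsto_integral_inner_of_eLpNorm_two (g := fun x => ψ x • v) (C := C' * ‖v‖)
    (fun n => (hφ n).memLp_gradient _) hG
    (hψ.continuous.smul continuous_const).aestronglyMeasurable
    (fun x => by rw [norm_smul]; exact mul_le_mul_of_nonneg_right (hC' x) (norm_nonneg _)) h2
  have e : ∀ n, ∫ x in Ω, inner ℝ (φ n x) (fderiv ℝ ψ x v)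
      = - ∫ x in Ω, inner ℝ (gradient (φ n) x) (ψ x • v) := by
    intro n
    have := (hφ n).integral_mul_fderiv hψ v
    simpa [inner_smul_right, mul_comm] using this
  simp only [e] at l1
  have := tendsto_nhds_unique l1 l2.neg
  simpa [inner_smul_right, mul_comm] using this

theorem HasH10Gradient.isWeakGradient (h : HasH10Gradient Ω u G) (hfin : volume Ω ≠ ⊤) :
    IsWeakGradient Ω u G := by
  have : IsFiniteMeasure (volume.restrict Ω) := ⟨by simpa using hfin.lt_top⟩
  refine ⟨IntegrableOn.locallyIntegrableOn (h.1.integrable (by norm_num)),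
    IntegrableOn.locallyIntegrableOn (h.2.1.integrable (by norm_num)), fun φ hφ v => ?_⟩
  exact h.integral_mul_fderiv hfin (hφ.1.of_le (by norm_cast)) hφ.2.1 v

theorem HasH10Gradient.memH10 (h : HasH10Gradient Ω u G) (hfin : volume Ω ≠ ⊤) : MemH10 Ω u :=
  ⟨h.1, G, h.isWeakGradient hfin, h.2.1, h.2.2⟩

/-- Fundamental lemma of the calculus of variations. It allows the chosen `weakGradient` to be
replaced by any concrete gradient. -/
theorem IsWeakGradient.ae_eq (hΩ : IsOpen Ω) {G' : Space N → Space N}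
    (h : IsWeakGradient Ω u G) (h' : IsWeakGradient Ω u G') : G =ᵐ[volume.restrict Ω] G' := by
  have key : ∀ᵐ x ∂volume, x ∈ Ω → (fun x => G x - G' x) x = 0 := by
    refine hΩ.ae_eq_zero_of_integral_contDiff_smul_eq_zero (h.2.1.sub h'.2.1) fun g hg hgc hgs => ?_
    have hint : ∀ F : Space N → Space N, LocallyIntegrableOn F Ω →
        Integrable (fun x => g x • F x) (volume.restrict Ω) := by
      intro F hF
      have hk : IntegrableOn F (tsupport g) := hF.integrableOn_compact_subset hgs hgc
      have h2 : Integrable (fun x => g x • F x) := by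
        rw [← integrableOn_iff_integrable_of_support_subset (s := tsupport g)]
        · exact hk.continuousOn_smul hg.continuous.continuousOn hgc
        · exact (Function.support_smul_subset_left _ _).trans (subset_tsupport g)
      exact h2.restrict
    rw [← setIntegral_eq_integral_of_forall_compl_eq_zero (s := Ω)]
    swap
    · intro x hx
      rw [image_eq_zero_of_notMem_tsupport fun h' => hx (hgs h'), zero_smul]
    simp only [smul_sub]
    rw [integral_sub (hint _ h.2.1) (hint _ h'.2.1), sub_eq_zero]
    refine ext_inner_left ℝ fun v => ?_
    rw [← integral_inner (hint _ h.2.1), ← integral_inner (hint _ h'.2.1)]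
    have e := (h.2.2 g ⟨hg, hgc, hgs⟩ v).symm.trans (h'.2.2 g ⟨hg, hgc, hgs⟩ v)
    simpa [inner_smul_right, mul_comm, real_inner_comm] using e
  rw [EventuallyEq, ae_restrict_iff' hΩ.measurableSet]
  filter_upwards [key] with x hx hxΩ using sub_eq_zero.1 (hx hxΩ)

theorem IsWeakGradient.weakGradient_ae_eq (hΩ : IsOpen Ω) (h : IsWeakGradient Ω u G) :
    weakGradient Ω u =ᵐ[volume.restrict Ω] G := by
  have he : ∃ G, IsWeakGradient Ω u G := ⟨G, h⟩
  rw [weakGradient, dif_pos he]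
  exact he.choose_spec.ae_eq hΩ h

theorem gradient_comp {β : ℝ → ℝ} {φ : Space N → ℝ} {x : Space N} (hβ : Differentiable ℝ β)
    (hφ : DifferentiableAt ℝ φ x) :
    gradient (fun x => β (φ x)) x = deriv β (φ x) • gradient φ x := by
  refine ext_inner_right ℝ fun v => ?_
  rw [inner_smul_left, inner_gradient_left, inner_gradient_left,
    HasFDerivAt.fderiv (f := fun x => β (φ x))
      ((hβ (φ x)).hasDerivAt.comp_hasFDerivAt x hφ.hasFDerivAt)]
  simp

/-- If `φ n` approximates `u`, then `β ∘ φ n` approximates `β ∘ u`; the condition `β 0 = 0` keeps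
the supports inside `Ω`. -/
theorem HasH10Gradient.comp (h : HasH10Gradient Ω u G) {β : ℝ → ℝ} (hβ : ContDiff ℝ ∞ β)
    (hβ0 : β 0 = 0) {K : ℝ} (hK : ∀ s, |deriv β s| ≤ K) :
    HasH10Gradient Ω (fun x => β (u x)) (fun x => deriv β (u x) • G x) := by
  obtain ⟨hu, hG, φ, hφ, h1, h2⟩ := h
  have hd : Differentiable ℝ β := hβ.differentiable (by simp)
  have hcd : Continuous (deriv β) := (contDiff_infty_iff_deriv.1 hβ).2.continuous
  have hlip : ∀ s r, |β s - β r| ≤ K * |s - r| := fun s r =>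
    convex_univ.norm_image_sub_le_of_norm_deriv_le (f := β) (fun x _ => hd x) (fun x _ => hK x)
      (Set.mem_univ r) (Set.mem_univ s)
  have hsm : ∀ n, AEStronglyMeasurable (φ n) (volume.restrict Ω) := fun n => ((hφ n).memLp _).1
  -- Almost everywhere convergence, needed for `β' (φ n) → β' (u)`, holds only along a subsequence.
  obtain ⟨ns, hns, hae⟩ := (tendstoInMeasure_of_tendsto_eLpNorm (by norm_num) hsm hu.1
    h1).exists_seq_tendsto_ae
  have hm1 : AEStronglyMeasurable (fun x => deriv β (u x)) (volume.restrict Ω) :=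
    hcd.comp_aestronglyMeasurable hu.1
  refine ⟨?_, ?_, fun n x => β (φ (ns n) x), fun n => ⟨hβ.comp (hφ _).1, ?_, ?_⟩, ?_, ?_⟩
  · refine hu.of_le_mul (c := K) (hβ.continuous.comp_aestronglyMeasurable hu.1)
      (Eventually.of_forall fun x => ?_)
    simpa [hβ0] using hlip (u x) 0
  · refine hG.of_le_mul (c := K) (hm1.smul hG.1) (Eventually.of_forall fun x => ?_)
    rw [norm_smul]
    exact mul_le_mul_of_nonneg_right (hK _) (norm_nonneg _)
  · exact (hφ _).2.1.comp_left hβ0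
  · exact (tsupport_comp_subset hβ0 _).trans (hφ _).2.2
  · have hub := ENNReal.Tendsto.const_mul (a := ENNReal.ofReal K)
      (h1.comp hns.tendsto_atTop) (Or.inr ENNReal.ofReal_ne_top)
    rw [mul_zero] at hub
    refine tendsto_of_tendsto_of_tendsto_of_le_of_le tendsto_const_nhds hub (fun _ => zero_le)
      (fun n => eLpNorm_le_mul_eLpNorm_of_ae_le_mul (Eventually.of_forall fun x => hlip _ _) 2)
  · have hub := ENNReal.Tendsto.const_mul (a := ENNReal.ofReal K)
      (h2.comp hns.tendsto_atTop) (Or.inr ENNReal.ofReal_ne_top)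
    rw [mul_zero] at hub
    have hm2 : ∀ n, AEStronglyMeasurable (fun x => deriv β (φ (ns n) x)) (volume.restrict Ω) :=
      fun n => hcd.comp_aestronglyMeasurable (hsm _)
    -- The gradient error splits into `β'(φ) (∇φ - G)`, controlled by the bound on `β'`, and `(β'(φ)
    -- - β'(u)) G`, which tends to zero by domination by `2 K |G|`.
    have hd2 : Tendsto (fun n => eLpNorm
        (fun x => (deriv β (φ (ns n) x) - deriv β (u x)) • G x) 2 (volume.restrict Ω))
        atTop (𝓝 0) := by
      refine tendsto_eLpNorm_two_zero_of_dominated (g := fun x => (2 * K) • G x)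
        (fun n => ((hm2 n).sub hm1).smul hG.1) (hG.const_smul (2 * K))
        (fun n => Eventually.of_forall fun x => ?_) ?_
      · rw [norm_smul, norm_smul]
        gcongr
        refine (norm_sub_le _ _).trans ((add_le_add (hK _) (hK _)).trans ?_)
        rw [← two_mul]
        exact le_abs_self _
      · filter_upwards [hae] with x hx
        have := ((hcd.tendsto (u x)).comp hx).sub_const (deriv β (u x))
        simpa [Function.comp_def] using this.smul_const (G x)
    have hsum := hub.add hd2
    rw [add_zero] at hsum
    refine tendsto_of_tendsto_of_tendsto_of_le_of_le tendsto_const_nhds hsum (fun _ => zero_le)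
      (fun n => ?_)
    have hg : ∀ x, gradient (fun x => β (φ (ns n) x)) x - deriv β (u x) • G x
        = deriv β (φ (ns n) x) • (gradient (φ (ns n)) x - G x)
          + (deriv β (φ (ns n) x) - deriv β (u x)) • G x := by
      intro x
      rw [gradient_comp hd ((hφ _).1.differentiable (by simp) x), smul_sub, sub_smul]
      abel
    simp only [hg]
    refine (eLpNorm_add_le ((hm2 n).smul (((hφ _).memLp_gradient _).1.sub hG.1))
      (((hm2 n).sub hm1).smul hG.1) (by norm_num)).trans (add_le_add ?_ le_rfl)
    refine eLpNorm_le_mul_eLpNorm_of_ae_le_mul (Eventually.of_forall fun x => ?_) 2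
    refine (norm_smul (deriv β (φ (ns n) x)) (gradient (φ (ns n)) x - G x)).trans_le ?_
    exact mul_le_mul_of_nonneg_right (hK _) (norm_nonneg _)

/-! ### Smooth truncations and cutoffs of the real line. -/

/-- Integrate a cutoff equal to `0` on `|r| ≤ 1` and `1` on `|r| ≥ 2`. Then `b s - s` is constant on
each half-line `|s| ≥ 2`, and for `|s| ≤ 2` it is at most `2 |s| ≤ 4`. -/
theorem exists_smooth_truncation_one : ∃ b : ℝ → ℝ, ContDiff ℝ ∞ b ∧
    (∀ s, |s| ≤ 1 → b s = 0 ∧ deriv b s = 0) ∧ (∀ s, 0 ≤ deriv b s ∧ deriv b s ≤ 1) ∧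
    (∀ s, |b s - s| ≤ 4) ∧ ∀ s, |b s| ≤ |s| := by
  set f : ℝ → ℝ := fun r => Real.smoothTransition (r ^ 2 - 1) with hf
  have hfs : ContDiff ℝ ∞ f :=
    Real.smoothTransition.contDiff.comp ((contDiff_id.pow 2).sub contDiff_const)
  set b : ℝ → ℝ := fun s => ∫ r in (0 : ℝ)..s, f r with hb
  have hder : ∀ s, HasDerivAt b (f s) s := fun s => hfs.continuous.integral_hasStrictDerivAt 0 s
    |>.hasDerivAt
  have hd : deriv b = f := funext fun s => (hder s).deriv
  have hdiff : Differentiable ℝ b := fun s => (hder s).differentiableAt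
  have hb0 : b 0 = 0 := by simp [hb]
  have hzero : ∀ s, |s| ≤ 1 → f s = 0 := fun s hs =>
    Real.smoothTransition.zero_of_nonpos (by
      have := sq_le_one_iff_abs_le_one s |>.2 hs
      linarith)
  have hone : ∀ s, 2 ≤ |s| → f s = 1 := fun s hs =>
    Real.smoothTransition.one_of_one_le (by
      have : 2 ^ 2 ≤ |s| ^ 2 := by gcongr
      rw [sq_abs] at this
      linarith)
  have hle : ∀ s, |b s| ≤ |s| := fun s => by
    have := convex_univ.norm_image_sub_le_of_norm_deriv_le (f := b) (C := 1) (fun x _ => hdiff x)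
      (fun x _ => by
        rw [hd, Real.norm_of_nonneg (Real.smoothTransition.nonneg _)]
        exact Real.smoothTransition.le_one _) (Set.mem_univ 0) (Set.mem_univ s)
    simpa [hb0] using this
  have hsmall : ∀ s, |s| ≤ 2 → |b s - s| ≤ 4 := fun s hs => by
    have := abs_sub (b s) s
    linarith [hle s]
  have hconst : ∀ c : Set ℝ, Convex ℝ c → (∀ s ∈ c, 2 ≤ |s|) → ∀ r ∈ c, ∀ s ∈ c,
      b s - s = b r - r := by
    intro c hc h2 r hr s hs
    have hder' : ∀ x ∈ c, HasDerivAt (fun s => b s - s) 0 x := fun x hx => by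
      have := (hder x).sub (hasDerivAt_id x)
      rw [hone x (h2 x hx), sub_self] at this
      exact this
    have := hc.norm_image_sub_le_of_norm_deriv_le (f := fun s => b s - s) (C := 0)
      (fun x hx => (hder' x hx).differentiableAt) (fun x hx => by simp [(hder' x hx).deriv]) hr hs
    rw [zero_mul] at this
    exact sub_eq_zero.1 (norm_le_zero_iff.1 this)
  refine ⟨b, contDiff_infty_iff_deriv.2 ⟨hdiff, hd ▸ hfs⟩, fun s hs => ⟨?_, hd ▸ hzero s hs⟩,
    fun s => hd ▸ ⟨Real.smoothTransition.nonneg _, Real.smoothTransition.le_one _⟩, fun s => ?_,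
    hle⟩
  · rw [hb]
    refine (intervalIntegral.integral_congr (g := fun _ => (0 : ℝ)) fun r hr => ?_).trans (by simp)
    refine hzero r (le_trans ?_ hs)
    simpa using Set.abs_sub_left_of_mem_uIcc hr
  · rcases le_total |s| 2 with h | h
    · exact hsmall s h
    · rcases le_abs.1 h with h' | h'
      · rw [hconst (Set.Ici 2) (convex_Ici 2) (fun x hx => le_trans hx (le_abs_self x)) 2
          Set.self_mem_Ici s h']
        exact hsmall 2 (by norm_num)
      · rw [hconst (Set.Iic (-2)) (convex_Iic _)
          (fun x hx => (le_neg.1 hx).trans (neg_le_abs x)) (-2) Set.self_mem_Iic s (le_neg.1 h')]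
        exact hsmall (-2) (by norm_num)

theorem exists_smooth_truncation {t : ℝ} (ht : 0 < t) : ∃ β : ℝ → ℝ, ContDiff ℝ ∞ β ∧
    (∀ s, |s| ≤ t → β s = 0 ∧ deriv β s = 0) ∧ (∀ s, 0 ≤ deriv β s ∧ deriv β s ≤ 1) ∧
    (∀ s, |β s - s| ≤ 4 * t) ∧ ∀ s, |β s| ≤ |s| := by
  obtain ⟨b, hb, h0, h1, h4, hle⟩ := exists_smooth_truncation_one
  have hdiff : Differentiable ℝ b := hb.differentiable (by simp)
  have hd : ∀ s, deriv (fun s => t * b (s / t)) s = deriv b (s / t) := fun s => by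
    have h := ((hdiff (s / t)).hasDerivAt.comp s ((hasDerivAt_id s).div_const t)).const_mul t
    have h' : HasDerivAt (fun s => t * b (s / t)) (t * (deriv b (s / t) * (1 / t))) s := h
    rw [h'.deriv]
    field_simp
  refine ⟨fun s => t * b (s / t), contDiff_const.mul (hb.comp (contDiff_id.div_const t)),
    fun s hs => ?_, fun s => ?_, fun s => ?_, fun s => ?_⟩
  · have : |s / t| ≤ 1 := by rwa [abs_div, abs_of_pos ht, div_le_one ht]
    rw [hd]
    exact ⟨by simp [(h0 _ this).1], (h0 _ this).2⟩
  · rw [hd]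
    exact h1 _
  · have : t * b (s / t) - s = t * (b (s / t) - s / t) := by field_simp
    rw [this, abs_mul, abs_of_pos ht, mul_comm]
    exact mul_le_mul_of_nonneg_right (h4 _) ht.le
  · rw [abs_mul, abs_of_pos ht]
    calc t * |b (s / t)| ≤ t * |s / t| := mul_le_mul_of_nonneg_left (hle _) ht.le
      _ = |s| := by rw [abs_div, abs_of_pos ht]; field_simp

/-- Smooth approximations of the indicator of `{s ≠ 0}`. -/
theorem exists_smooth_approx_indicator : ∃ K : ℝ, 0 < K ∧ ∀ t : ℝ, 0 < t → ∃ γ : ℝ → ℝ,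
    ContDiff ℝ ∞ γ ∧ γ 0 = 0 ∧ (∀ s, |γ s| ≤ 1) ∧ (∀ s, t ≤ |s| → γ s = 1) ∧
    (∀ s, |deriv γ s| ≤ K / t) ∧ ∀ s, s = 0 ∨ t < |s| → deriv γ s = 0 := by
  set g : ℝ → ℝ := fun s => Real.smoothTransition (s ^ 2) with hg
  have hgs : ContDiff ℝ ∞ g := Real.smoothTransition.contDiff.comp (contDiff_id.pow 2)
  have hdiff : Differentiable ℝ g := hgs.differentiable (by simp)
  have hone : ∀ s, 1 ≤ |s| → g s = 1 := fun s hs =>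
    Real.smoothTransition.one_of_one_le ((one_le_sq_iff_one_le_abs s).2 hs)
  -- `g` is nonnegative and vanishes at `0`, hence has a minimum there.
  have hd0 : deriv g 0 = 0 := by
    refine IsLocalMin.deriv_eq_zero (Eventually.of_forall fun s => ?_)
    simpa [hg] using Real.smoothTransition.nonneg (s ^ 2)
  have hd1 : ∀ s, 1 < |s| → deriv g s = 0 := fun s hs => by
    have : g =ᶠ[𝓝 s] fun _ => 1 := by
      filter_upwards [continuous_abs.continuousAt.eventually_const_lt hs] with r hr
        using hone r hr.le
    rw [this.deriv_eq, deriv_const]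
  obtain ⟨C, hC⟩ := (isCompact_Icc (a := (-1 : ℝ)) (b := 1)).exists_bound_of_continuousOn
    (contDiff_infty_iff_deriv.1 hgs).2.continuous.continuousOn
  have hK : ∀ s, |deriv g s| ≤ |C| + 1 := fun s => by
    rcases le_or_gt |s| 1 with h | h
    · exact (hC s (abs_le.1 h)).trans ((le_abs_self C).trans (by linarith))
    · rw [hd1 s h, abs_zero]
      positivity
  refine ⟨|C| + 1, by positivity, fun t ht => ?_⟩
  have hd : ∀ s, deriv (fun s => g (s / t)) s = deriv g (s / t) / t := fun s => by
    have h := (hdiff (s / t)).hasDerivAt.comp s ((hasDerivAt_id s).div_const t)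
    have h' : HasDerivAt (fun s => g (s / t)) (deriv g (s / t) * (1 / t)) s := h
    rw [h'.deriv, mul_one_div]
  refine ⟨fun s => g (s / t), hgs.comp (contDiff_id.div_const t), by simp [hg], fun s => ?_,
    fun s hs => hone _ ?_, fun s => ?_, fun s hs => ?_⟩
  · rw [abs_of_nonneg (Real.smoothTransition.nonneg _)]
    exact Real.smoothTransition.le_one _
  · rwa [abs_div, abs_of_pos ht, one_le_div ht]
  · rw [hd, abs_div, abs_of_pos ht]
    gcongr
    exact hK _
  · rw [hd]
    rcases hs with rfl | hs
    · simp [hd0]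
    · rw [hd1 _ (by rwa [abs_div, abs_of_pos ht, one_lt_div ht]), zero_div]

/-! ### Divergence and the perimeter of the nodal set. -/

theorem continuous_divergence {φ : Space N → Space N} (hφ : ContDiff ℝ 1 φ) :
    Continuous (divergence φ) := by
  unfold divergence
  refine continuous_finsetSum _ fun i _ => ?_
  exact (EuclideanSpace.proj (𝕜 := ℝ) i).continuous.comp
    ((hφ.continuous_fderiv (by norm_num)).clm_apply continuous_const)

theorem exists_bound_divergence {φ : Space N → Space N} (hφ : ContDiff ℝ 1 φ)
    (hc : HasCompactSupport φ) : ∃ C, ∀ x, ‖divergence φ x‖ ≤ C := by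
  refine HasCompactSupport.exists_bound_of_continuous ?_ (continuous_divergence hφ)
  refine hc.mono' fun x hx => ?_
  by_contra h'
  have : fderiv ℝ φ x = 0 := image_eq_zero_of_notMem_tsupport
    (fun h => h' (tsupport_fderiv_subset ℝ h))
  exact hx (by simp [divergence, this])

theorem HasH10Gradient.integral_mul_divergence (h : HasH10Gradient Ω u G)
    (hfin : volume Ω ≠ ⊤) {φ : Space N → Space N} (hφ : ContDiff ℝ 1 φ)
    (hφc : HasCompactSupport φ) :
    ∫ x in Ω, u x * divergence φ x = - ∫ x in Ω, inner ℝ (G x) (φ x) := by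
  have : IsFiniteMeasure (volume.restrict Ω) := ⟨by simpa using hfin.lt_top⟩
  have hcomp : ∀ i, ContDiff ℝ 1 fun x => φ x i := fun i =>
    (EuclideanSpace.proj (𝕜 := ℝ) i).contDiff.comp hφ
  have hcs : ∀ i, HasCompactSupport fun x => φ x i := fun i =>
    hφc.comp_left (g := fun y : Space N => y i) rfl
  have hfd : ∀ i x v, fderiv ℝ (fun x => φ x i) x v = (fderiv ℝ φ x v) i := fun i x v => by
    have := ((EuclideanSpace.proj (𝕜 := ℝ) i).hasFDerivAt (x := φ x)).comp x
      (hφ.differentiable (by norm_num) x).hasFDerivAt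
    rw [HasFDerivAt.fderiv (f := fun x => φ x i) this]
    rfl
  have hui := h.1.integrable (by norm_num)
  have hGi := h.2.1.integrable (by norm_num)
  have e1 : ∀ x, u x * divergence φ x
      = ∑ i, u x * fderiv ℝ (fun x => φ x i) x (EuclideanSpace.single i 1) := fun x => by
    simp only [hfd, divergence, Finset.mul_sum]
  have e2 : ∀ x, inner ℝ (G x) (φ x)
      = ∑ i, inner ℝ (G x) (EuclideanSpace.single i (1 : ℝ)) * φ x i := fun x => by
    simp [PiLp.inner_apply, mul_comm]
  simp only [e1, e2]
  rw [integral_finsetSum, integral_finsetSum, ← Finset.sum_neg_distrib]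
  · exact Finset.sum_congr rfl fun i _ => h.integral_mul_fderiv hfin (hcomp i) (hcs i) _
  · intro i _
    obtain ⟨C, hC⟩ := (hcs i).exists_bound_of_continuous (hcomp i).continuous
    exact (hGi.inner_const _).mul_bdd (hcomp i).continuous.aestronglyMeasurable
      (Eventually.of_forall hC)
  · intro i _
    have hc : Continuous fun x => fderiv ℝ (fun x => φ x i) x (EuclideanSpace.single i 1) :=
      ((hcomp i).continuous_fderiv (by norm_num)).clm_apply continuous_const
    obtain ⟨C, hC⟩ := ((hcs i).fderiv_apply ℝ _).exists_bound_of_continuous hc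
    exact hui.mul_bdd hc.aestronglyMeasurable (Eventually.of_forall hC)

theorem nullMeasurableSet_ne_zero {α : Type*} [MeasurableSpace α] {μ : Measure α} {u : α → ℝ}
    (hu : AEStronglyMeasurable u μ) : NullMeasurableSet {x | u x ≠ 0} μ :=
  hu.aemeasurable.nullMeasurableSet_preimage (measurableSet_singleton 0).compl

theorem nullMeasurableSet_abs_le {α : Type*} [MeasurableSpace α] {μ : Measure α} {u : α → ℝ}
    (hu : AEStronglyMeasurable u μ) (t : ℝ) : NullMeasurableSet {x | |u x| ≤ t} μ :=
  hu.norm.aemeasurable.nullMeasurableSet_preimage measurableSet_Iic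

theorem nullMeasurableSet_layer {α : Type*} [MeasurableSpace α] {μ : Measure α} {u : α → ℝ}
    (hu : AEStronglyMeasurable u μ) (t : ℝ) : NullMeasurableSet {x | u x ≠ 0 ∧ |u x| ≤ t} μ :=
  (nullMeasurableSet_ne_zero hu).inter (nullMeasurableSet_abs_le hu t)

theorem setIntegral_nodalSet (hu : AEStronglyMeasurable u (volume.restrict Ω))
    (f : Space N → ℝ) :
    ∫ x in nodalSet Ω u, f x = ∫ x in Ω, {x | u x ≠ 0}.indicator f x := by
  rw [integral_indicator₀ (nullMeasurableSet_ne_zero hu),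
    Measure.restrict_restrict₀ (nullMeasurableSet_ne_zero hu)]
  congr 2
  ext x
  exact and_comm

/-- A discrete substitute for the coarea argument: `-∫ γ_t'(u) G · φ` is at most `K / t` times the
integral of `|G|` over the layer, hence at most `K B` for every small `t`. The constant `K` comes
from the cutoff alone, so it does not depend on the dimension. -/
theorem perimeter_nodalSet_le : ∃ K : ℝ, 0 < K ∧ ∀ {N : ℕ} {Ω : Set (Space N)} {u : Space N → ℝ}
    {G : Space N → Space N} {B δ : ℝ}, volume Ω ≠ ⊤ → HasH10Gradient Ω u G → 0 < δ →
    (∀ t, 0 < t → t ≤ δ →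
      ∫ x in Ω, {x | u x ≠ 0 ∧ |u x| ≤ t}.indicator (fun x => ‖G x‖) x ≤ B * t) →
    perimeter (nodalSet Ω u) ≤ ENNReal.ofReal (K * B) := by
  obtain ⟨K, hK, hγ⟩ := exists_smooth_approx_indicator
  refine ⟨K, hK, fun {N Ω u G B δ} hfin h hδ hB => iSup₂_le fun φ hφ =>
    ENNReal.ofReal_le_ofReal ?_⟩
  obtain ⟨hφ, hφc, hφ1⟩ := hφ
  have : IsFiniteMeasure (volume.restrict Ω) := ⟨by simpa using hfin.lt_top⟩
  choose! γ hs h0 hle hone hder hder0 using hγ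
  have hpos : ∀ n : ℕ, 0 < δ / (n + 1) := fun n => by positivity
  rw [setIntegral_nodalSet h.1.1]
  obtain ⟨C, hC⟩ := exists_bound_divergence hφ hφc
  have hlim : Tendsto (fun n : ℕ => ∫ x in Ω, γ (δ / (n + 1)) (u x) * divergence φ x) atTop
      (𝓝 (∫ x in Ω, {x | u x ≠ 0}.indicator (divergence φ) x)) := by
    refine tendsto_integral_of_dominated_convergence (fun _ => C) (fun n => ?_)
      (integrable_const C) (fun n => Eventually.of_forall fun x => ?_)
      (Eventually.of_forall fun x => ?_)
    · exact ((hs _ (hpos n)).continuous.comp_aestronglyMeasurable h.1.1).mul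
        (continuous_divergence hφ).aestronglyMeasurable
    · rw [norm_mul]
      exact (mul_le_of_le_one_left (norm_nonneg _) (hle _ (hpos n) _)).trans (hC x)
    · by_cases hx : u x = 0
      · simp [hx, h0 _ (hpos _)]
      · rw [Set.indicator_of_mem (show x ∈ {x | u x ≠ 0} from hx)]
        refine tendsto_const_nhds.congr' ?_
        have hz : Tendsto (fun n : ℕ => δ / ((n : ℝ) + 1)) atTop (𝓝 0) := by
          have := (tendsto_one_div_add_atTop_nhds_zero_nat (𝕜 := ℝ)).const_mul δ
          simpa [div_eq_mul_inv] using this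
        filter_upwards [hz.eventually_lt_const (abs_pos.2 hx)] with n hn
        rw [hone _ (hpos n) _ hn.le, one_mul]
  refine le_of_tendsto' hlim fun n => ?_
  set t := δ / ((n : ℝ) + 1) with ht
  have htpos : 0 < t := hpos n
  have htδ : t ≤ δ := div_le_self hδ.le (by linarith [n.cast_nonneg (α := ℝ)])
  have hcomp := h.comp (hs t htpos) (h0 t htpos) (hder t htpos)
  rw [hcomp.integral_mul_divergence hfin hφ hφc]
  have hGi := (h.2.1.integrable (by norm_num)).norm
  have hle' : ∀ x, ‖inner ℝ (deriv (γ t) (u x) • G x) (φ x)‖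
      ≤ K / t * {x | u x ≠ 0 ∧ |u x| ≤ t}.indicator (fun x => ‖G x‖) x := fun x => by
    refine (norm_inner_le_norm _ _).trans
      ((mul_le_of_le_one_right (norm_nonneg _) (hφ1 x)).trans ?_)
    rw [norm_smul]
    by_cases hx : x ∈ {x | u x ≠ 0 ∧ |u x| ≤ t}
    · rw [Set.indicator_of_mem hx]
      exact mul_le_mul_of_nonneg_right (hder t htpos _) (norm_nonneg _)
    -- Since `γ_t'` vanishes at `0`, the set `{u = 0}` contributes nothing, without knowing that `G
    -- = 0` almost everywhere there.
    · rw [Set.indicator_of_notMem hx, hder0 t htpos, norm_zero, zero_mul, mul_zero]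
      by_contra! hcon
      exact hx ⟨hcon.1, hcon.2⟩
  calc -∫ x in Ω, inner ℝ (deriv (γ t) (u x) • G x) (φ x)
      ≤ ‖∫ x in Ω, inner ℝ (deriv (γ t) (u x) • G x) (φ x)‖ := neg_le_abs _
    _ ≤ ∫ x in Ω, K / t * {x | u x ≠ 0 ∧ |u x| ≤ t}.indicator (fun x => ‖G x‖) x :=
        norm_integral_le_of_norm_le
          ((hGi.indicator₀ (nullMeasurableSet_layer h.1.1 t)).const_mul _)
          (Eventually.of_forall hle')
    _ ≤ K / t * (B * t) := by
        rw [integral_const_mul]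
        exact mul_le_mul_of_nonneg_left (hB t htpos htδ) (by positivity)
    _ = K * B := by field_simp

/-! ### Minimality and the energy of thin layers. -/

/-- The Rayleigh quotient `∫_Ω |∇u|² / ∫_Ω u²`. -/
def rayleigh (Ω : Set (Space N)) (u : Space N → ℝ) : ℝ :=
  (∫ x in Ω, ‖weakGradient Ω u x‖ ^ 2) / (∫ x in Ω, (u x) ^ 2)

theorem rayleigh_nonneg (Ω : Set (Space N)) (u : Space N → ℝ) : 0 ≤ rayleigh Ω u :=
  div_nonneg (integral_nonneg fun _ => by positivity) (integral_nonneg fun _ => by positivity)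

theorem HasH10Gradient.rayleigh_eq (h : HasH10Gradient Ω u G) (hΩ : IsOpen Ω)
    (hfin : volume Ω ≠ ⊤) :
    rayleigh Ω u = (∫ x in Ω, ‖G x‖ ^ 2) / (∫ x in Ω, (u x) ^ 2) := by
  rw [rayleigh, integral_congr_ae]
  filter_upwards [(h.isWeakGradient hfin).weakGradient_ae_eq hΩ] with x hx
  rw [hx]

theorem volume_real_nodalSet (hΩ : IsOpen Ω) (u : Space N → ℝ) :
    volume.real (nodalSet Ω u) = (volume.restrict Ω).real {x | u x ≠ 0} := by
  rw [measureReal_def, measureReal_def, Measure.restrict_apply' hΩ.measurableSet]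
  congr 2
  ext x
  exact and_comm

/-- Both slopes `η` and `1 / η` are at least `η`, because `η ≤ 1`. -/
theorem penalty_sub_ge {a η s r : ℝ} (hη : 0 < η) (hη1 : η ≤ 1) (hrs : r ≤ s) :
    η * (s - r) ≤ penalty a η s - penalty a η r := by
  have h1 : η ≤ 1 / η := hη1.trans (by rw [le_div_iff₀ hη]; linarith)
  unfold penalty
  split_ifs with hs hr hr
  · nlinarith
  · nlinarith
  · linarith
  · linarith

/-- Segregation survives because `v` vanishes wherever `u i` does. -/
theorem update_mem_admissible {k : ℕ} {u : Fin k → Space N → ℝ} (hu : u ∈ admissible Ω k)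
    (i : Fin k) {v : Space N → ℝ} (hv : MemH10 Ω v) (hv0 : ¬ (v =ᵐ[volume.restrict Ω] 0))
    (hz : ∀ x, u i x = 0 → v x = 0) : Function.update u i v ∈ admissible Ω k := by
  obtain ⟨h1, h2, h3⟩ := hu
  refine ⟨fun j => ?_, fun j => ?_, fun j l hjl => ?_⟩
  · rcases eq_or_ne j i with rfl | hj
    · simpa using hv
    · simpa [hj] using h1 j
  · rcases eq_or_ne j i with rfl | hj
    · simpa using hv0
    · simpa [hj] using h2 j
  · filter_upwards [h3 j l hjl] with x hx
    rcases eq_or_ne j i with rfl | hj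
    · rw [Function.update_self, Function.update_of_ne hjl.symm]
      rcases mul_eq_zero.1 hx with h | h
      · simp [hz x h]
      · simp [h]
    · rw [Function.update_of_ne hj]
      rcases eq_or_ne l i with rfl | hl
      · rw [Function.update_self]
        rcases mul_eq_zero.1 hx with h | h
        · simp [h]
        · simp [hz x h]
      · rwa [Function.update_of_ne hl]

theorem sum_update {k : ℕ} {β : Type*} (u : Fin k → β) (i : Fin k) (v : β) (f : β → ℝ) :
    ∑ j, f (Function.update u i v j) = ∑ j, f (u j) - f (u i) + f v := by
  rw [Finset.sum_eq_add_sum_sdiff_singleton_of_mem (Finset.mem_univ i),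
    Finset.sum_eq_add_sum_sdiff_singleton_of_mem (Finset.mem_univ i) (fun j => f (u j)),
    Finset.sum_congr rfl fun j hj => ?_]
  · rw [Function.update_self]
    ring
  · rw [Function.update_of_ne]
    simpa using hj

theorem IsNormalizedMinimizer.rayleigh_add_le {k : ℕ} {a η : ℝ} {u : Fin k → Space N → ℝ}
    (h : IsNormalizedMinimizer Ω k a η u) (hη : 0 < η) (hη1 : η ≤ 1)
    (i : Fin k) {v : Space N → ℝ} (hv : MemH10 Ω v) (hv0 : ¬ (v =ᵐ[volume.restrict Ω] 0))
    (hz : ∀ x, u i x = 0 → v x = 0)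
    (hle : volume.real (nodalSet Ω v) ≤ volume.real (nodalSet Ω (u i))) :
    rayleigh Ω (u i) + η * (volume.real (nodalSet Ω (u i)) - volume.real (nodalSet Ω v))
      ≤ rayleigh Ω v := by
  have hmin : functionalJ Ω k a η u ≤ functionalJ Ω k a η (Function.update u i v) :=
    h.2.1 (update_mem_admissible h.1 i hv hv0 hz)
  have e1 := sum_update u i v (rayleigh Ω)
  have e2 := sum_update u i v (fun w => volume.real (nodalSet Ω w))
  simp only [rayleigh] at e1
  unfold functionalJ at hmin
  rw [e1, e2] at hmin
  have := penalty_sub_ge (a := a) (s := ∑ j, volume.real (nodalSet Ω (u j)))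
    (r := ∑ j, volume.real (nodalSet Ω (u j)) - volume.real (nodalSet Ω (u i))
      + volume.real (nodalSet Ω v)) hη hη1 (by linarith)
  unfold rayleigh
  have e3 : ∑ j, volume.real (nodalSet Ω (u j)) - (∑ j, volume.real (nodalSet Ω (u j))
      - volume.real (nodalSet Ω (u i)) + volume.real (nodalSet Ω v))
      = volume.real (nodalSet Ω (u i)) - volume.real (nodalSet Ω v) := by ring
  rw [e3] at this
  linarith

theorem MemH10.hasH10Gradient (h : MemH10 Ω u) : ∃ G, HasH10Gradient Ω u G := by
  obtain ⟨hu, G, _, hG, h'⟩ := h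
  exact ⟨G, hu, hG, h'⟩

theorem IsNormalizedMinimizer.layer_energy_le {k : ℕ} {a η : ℝ} {u : Fin k → Space N → ℝ}
    (h : IsNormalizedMinimizer Ω k a η u) (hΩ : IsOpen Ω) (hfin : volume Ω ≠ ⊤)
    (hη : 0 < η) (hη1 : η ≤ 1) (i : Fin k) (hG : HasH10Gradient Ω (u i) G)
    {t A : ℝ} (ht : 0 < t) (hA : A = 4 * (volume.real Ω + 1)) (htA : A * t ≤ 1 / 2) :
    (∫ x in Ω, {x | |u i x| ≤ t}.indicator (fun x => ‖G x‖ ^ 2) x)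
      + η * (volume.restrict Ω).real {x | u i x ≠ 0 ∧ |u i x| ≤ t} * (1 - A * t)
      ≤ A * t * ∫ x in Ω, ‖G x‖ ^ 2 := by
  have : IsFiniteMeasure (volume.restrict Ω) := ⟨by simpa using hfin.lt_top⟩
  obtain ⟨β, hβs, hβ0, hβ1, hβ4, hβle⟩ := exists_smooth_truncation ht
  have hβz : β 0 = 0 := (hβ0 0 (by simpa using ht.le)).1
  have hv := hG.comp hβs hβz (K := 1) fun s => by
    rw [abs_of_nonneg (hβ1 s).1]
    exact (hβ1 s).2
  have hum := hG.1.1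
  have hu2 : Integrable (fun x => u i x ^ 2) (volume.restrict Ω) := hG.1.integrable_sq
  have hG2 : Integrable (fun x => ‖G x‖ ^ 2) (volume.restrict Ω) := hG.2.1.norm.integrable_sq
  have hv2 : Integrable (fun x => β (u i x) ^ 2) (volume.restrict Ω) := hv.1.integrable_sq
  have hvG2 : Integrable (fun x => ‖deriv β (u i x) • G x‖ ^ 2) (volume.restrict Ω) :=
    hv.2.1.norm.integrable_sq
  have hnorm : ∫ x in Ω, u i x ^ 2 = 1 := h.2.2 i
  -- `β² - u² = (β - u)(β + u)` is at least `-4 t · 2 |u| ≥ -4 t (1 + u²)`; integrating with `∫ u² =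
  -- 1` produces `A = 4 (|Ω| + 1)`.
  have hmass : 1 - A * t ≤ ∫ x in Ω, β (u i x) ^ 2 := by
    have hlow : ∀ x, u i x ^ 2 - 4 * t * (1 + u i x ^ 2) ≤ β (u i x) ^ 2 := fun x => by
      have h1 : |(β (u i x) - u i x) * (β (u i x) + u i x)| ≤ 4 * t * (2 * |u i x|) := by
        rw [abs_mul]
        refine mul_le_mul (hβ4 _) ?_ (abs_nonneg _) (by positivity)
        exact (abs_add_le _ _).trans (by linarith [hβle (u i x)])
      have h2 : 2 * |u i x| ≤ 1 + u i x ^ 2 := by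
        nlinarith [sq_nonneg (|u i x| - 1), sq_abs (u i x)]
      have h3 : 4 * t * (2 * |u i x|) ≤ 4 * t * (1 + u i x ^ 2) := by gcongr
      have h4 := neg_abs_le ((β (u i x) - u i x) * (β (u i x) + u i x))
      nlinarith
    have hint : Integrable (fun x => 4 * t * (1 + u i x ^ 2)) (volume.restrict Ω) :=
      ((integrable_const 1).add hu2).const_mul _
    have := integral_mono (hu2.sub hint) hv2 hlow
    rw [integral_sub' hu2 hint, integral_const_mul, integral_add (integrable_const 1) hu2,
      hnorm, integral_const] at this
    refine le_trans (le_of_eq ?_) this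
    simp [hA]
    ring
  have hmpos : 0 < ∫ x in Ω, β (u i x) ^ 2 := by linarith
  have henergy : ∫ x in Ω, ‖deriv β (u i x) • G x‖ ^ 2 ≤ (∫ x in Ω, ‖G x‖ ^ 2)
      - ∫ x in Ω, {x | |u i x| ≤ t}.indicator (fun x => ‖G x‖ ^ 2) x := by
    have hi := hG2.indicator₀ (nullMeasurableSet_abs_le hum t)
    rw [← integral_sub hG2 hi]
    refine integral_mono hvG2 (hG2.sub hi) fun x => ?_
    change ‖deriv β (u i x) • G x‖ ^ 2
      ≤ ‖G x‖ ^ 2 - {x | |u i x| ≤ t}.indicator (fun x => ‖G x‖ ^ 2) x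
    by_cases hx : |u i x| ≤ t
    · rw [Set.indicator_of_mem (show x ∈ {x | |u i x| ≤ t} from hx), (hβ0 _ hx).2]
      simp
    · rw [Set.indicator_of_notMem (show x ∉ {x | |u i x| ≤ t} from hx), sub_zero, norm_smul,
        Real.norm_of_nonneg (hβ1 _).1]
      exact pow_le_pow_left₀ (mul_nonneg (hβ1 _).1 (norm_nonneg _))
        (mul_le_of_le_one_left (norm_nonneg (G x)) (hβ1 _).2) 2
  have hmeas : volume.real (nodalSet Ω fun x => β (u i x))
      + (volume.restrict Ω).real {x | u i x ≠ 0 ∧ |u i x| ≤ t}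
      ≤ volume.real (nodalSet Ω (u i)) := by
    rw [volume_real_nodalSet hΩ, volume_real_nodalSet hΩ,
      ← measureReal_union₀ (nullMeasurableSet_layer hum t)]
    · refine measureReal_mono ?_
      rintro x (hx | hx)
      · intro h0
        exact hx (by simp [h0, hβz])
      · exact hx.1
    · refine Disjoint.aedisjoint (Set.disjoint_left.2 fun x hx hx' => ?_)
      exact hx (hβ0 _ hx'.2).1
  have hv0 : ¬ ((fun x => β (u i x)) =ᵐ[volume.restrict Ω] 0) := fun h0 => by
    refine hmpos.ne' (integral_eq_zero_of_ae ?_)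
    filter_upwards [h0] with x hx
    simp only [Pi.zero_apply] at hx ⊢
    rw [hx]
    simp
  have hμ0 : 0 ≤ (volume.restrict Ω).real {x | u i x ≠ 0 ∧ |u i x| ≤ t} := measureReal_nonneg
  have hmain := h.rayleigh_add_le hη hη1 i (hv.memH10 hfin) hv0
    (fun x hx => by simp [hx, hβz]) (by linarith)
  rw [hG.rayleigh_eq hΩ hfin, hv.rayleigh_eq hΩ hfin, hnorm, div_one, le_div_iff₀ hmpos] at hmain
  have hl0 : 0 ≤ ∫ x in Ω, ‖G x‖ ^ 2 := integral_nonneg fun _ => by positivity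
  set μ := (volume.restrict Ω).real {x | u i x ≠ 0 ∧ |u i x| ≤ t}
  set l := ∫ x in Ω, ‖G x‖ ^ 2
  -- Bounds the support loss below by `μ` and the mass below by `1 - A t`; combined with `hmain` and
  -- `henergy`, this leaves `(l + η μ)(1 - A t) ≤ l - D`.
  have h1 : (l + η * μ) * (1 - A * t) ≤ (l + η * (volume.real (nodalSet Ω (u i))
      - volume.real (nodalSet Ω fun x => β (u i x)))) * ∫ x in Ω, β (u i x) ^ 2 := by
    refine mul_le_mul ?_ hmass (by linarith) ?_
    · gcongr
      linarith
    · exact add_nonneg hl0 (mul_nonneg hη.le (by linarith))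
  linarith

theorem IsNormalizedMinimizer.layer_integral_le {k : ℕ} {a η : ℝ} {u : Fin k → Space N → ℝ}
    (h : IsNormalizedMinimizer Ω k a η u) (hΩ : IsOpen Ω) (hfin : volume Ω ≠ ⊤)
    (hη : 0 < η) (hη1 : η ≤ 1) (i : Fin k) (hG : HasH10Gradient Ω (u i) G)
    {t A : ℝ} (ht : 0 < t) (hA : A = 4 * (volume.real Ω + 1)) (htA : A * t ≤ 1 / 2) :
    ∫ x in Ω, {x | u i x ≠ 0 ∧ |u i x| ≤ t}.indicator (fun x => ‖G x‖) x
      ≤ 3 / 2 * A * (∫ x in Ω, ‖G x‖ ^ 2) / √η * t := by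
  have : IsFiniteMeasure (volume.restrict Ω) := ⟨by simpa using hfin.lt_top⟩
  have hE := h.layer_energy_le hΩ hfin hη hη1 i hG ht hA htA
  have hum := hG.1.1
  have hG2 : Integrable (fun x => ‖G x‖ ^ 2) (volume.restrict Ω) := hG.2.1.norm.integrable_sq
  have hG1 := (hG.2.1.integrable (by norm_num)).norm
  have hD0 : 0 ≤ ∫ x in Ω, {x | |u i x| ≤ t}.indicator (fun x => ‖G x‖ ^ 2) x :=
    integral_nonneg fun x => Set.indicator_nonneg (fun _ _ => by positivity) x
  have hμ0 : 0 ≤ (volume.restrict Ω).real {x | u i x ≠ 0 ∧ |u i x| ≤ t} := measureReal_nonneg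
  have hs : 0 < √η := Real.sqrt_pos.2 hη
  have hi := hG2.indicator₀ (nullMeasurableSet_abs_le hum t)
  have hS := nullMeasurableSet_layer hum t
  have hi1 : Integrable ({x | u i x ≠ 0 ∧ |u i x| ≤ t}.indicator fun _ => (1 : ℝ))
      (volume.restrict Ω) := (integrable_const 1).indicator₀ hS
  -- Young's inequality `|G| ≤ |G|² / (2 √η) + √η / 2` on the layer; this weight balances `D`
  -- against `η μ` and is the source of `η^{-1/2}`.
  have hmono := integral_mono (hG1.indicator₀ hS)
    ((hi.const_mul (1 / (2 * √η))).add (hi1.const_mul (√η / 2))) fun x => by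
      simp only [Pi.add_apply]
      by_cases hx : x ∈ {x | u i x ≠ 0 ∧ |u i x| ≤ t}
      · rw [Set.indicator_of_mem hx, Set.indicator_of_mem hx,
          Set.indicator_of_mem (show x ∈ {x | |u i x| ≤ t} from hx.2)]
        have : 1 / (2 * √η) * ‖G x‖ ^ 2 + √η / 2 * 1 - ‖G x‖
            = (‖G x‖ - √η) ^ 2 / (2 * √η) := by
          field_simp
          ring
        have h2 : 0 ≤ (‖G x‖ - √η) ^ 2 / (2 * √η) := by positivity
        linarith
      · rw [Set.indicator_of_notMem hx, Set.indicator_of_notMem hx, mul_zero, add_zero]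
        exact mul_nonneg (by positivity) (Set.indicator_nonneg (fun _ _ => by positivity) x)
  refine hmono.trans ?_
  simp only [Pi.add_apply]
  rw [integral_add (hi.const_mul _) (hi1.const_mul _), integral_const_mul, integral_const_mul,
    integral_indicator₀ hS, setIntegral_const, smul_eq_mul, mul_one]
  set D := ∫ x in Ω, {x | |u i x| ≤ t}.indicator (fun x => ‖G x‖ ^ 2) x
  set μ := (volume.restrict Ω).real {x | u i x ≠ 0 ∧ |u i x| ≤ t}
  set l := ∫ x in Ω, ‖G x‖ ^ 2
  have hημ : 0 ≤ η * μ := by positivity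
  have h1 : D ≤ A * t * l := by nlinarith
  have h2 : η * μ ≤ 2 * (A * t * l) := by nlinarith
  have h3 : 1 / (2 * √η) * D + √η / 2 * μ = (D + η * μ) / (2 * √η) := by
    field_simp
    rw [Real.sq_sqrt hη.le]
    ring
  rw [h3, div_le_iff₀ (by positivity)]
  have h4 : 3 / 2 * A * l / √η * t * (2 * √η) = 3 * (A * t * l) := by
    field_simp
  rw [h4]
  linarith

/-! ### Energy bound uniform in `η`. -/

/-- A nonempty open set in dimension `N ≥ 1` is infinite, so it contains `k` distinct points; bumps
in sufficiently small balls around them are disjoint, and their total volume scales like `δ ^ N`. -/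
theorem exists_bump_admissible (hN : 1 ≤ N) (hΩ : IsOpen Ω) (hne : Ω.Nonempty)
    (hfin : volume Ω ≠ ⊤) (k : ℕ) {a : ℝ} (ha : 0 < a) :
    ∃ w ∈ admissible Ω k, ∑ i, volume.real (nodalSet Ω (w i)) ≤ a := by
  have : Nonempty (Fin N) := ⟨⟨0, hN⟩⟩
  have hinf : Ω.Infinite := by
    obtain ⟨x, hx⟩ := hne
    exact infinite_of_mem_nhds x (hΩ.mem_nhds hx)
  have : Infinite Ω := hinf.to_subtype
  set p : Fin k → Ω := fun i => Infinite.natEmbedding Ω i with hp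
  have hpinj : ∀ i j, i ≠ j → (p i : Space N) ≠ p j := fun i j hij he =>
    hij (Fin.ext ((Infinite.natEmbedding Ω).injective (Subtype.ext he)))
  have hball : ∀ i, ∀ᶠ δ in 𝓝[>] (0 : ℝ), Metric.closedBall (p i : Space N) δ ⊆ Ω := fun i => by
    obtain ⟨ε, hε, hsub⟩ := Metric.isOpen_iff.1 hΩ (p i) (p i).2
    filter_upwards [Ioo_mem_nhdsGT hε] with δ hδ
    exact (Metric.closedBall_subset_ball hδ.2).trans hsub
  have hdisj : ∀ i j, i ≠ j → ∀ᶠ δ in 𝓝[>] (0 : ℝ),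
      Disjoint (Metric.ball (p i : Space N) δ) (Metric.ball (p j : Space N) δ) := fun i j hij => by
    have hd : 0 < dist (p i : Space N) (p j) / 2 := half_pos (dist_pos.2 (hpinj i j hij))
    filter_upwards [Ioo_mem_nhdsGT hd] with δ hδ
    exact Metric.ball_disjoint_ball (by linarith [hδ.2])
  have hvol : ∀ᶠ δ in 𝓝[>] (0 : ℝ), ∑ i, volume.real (Metric.ball (p i : Space N) δ) < a := by
    have : Tendsto (fun δ => ∑ i, volume.real (Metric.ball (p i : Space N) δ)) (𝓝[>] (0 : ℝ))
        (𝓝 (∑ _i : Fin k, 0)) := by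
      refine tendsto_finsetSum _ fun i _ => ?_
      have hc : Tendsto (fun δ : ℝ => δ ^ N * volume.real (Metric.ball (0 : Space N) 1))
          (𝓝[>] 0) (𝓝 0) := by
        have : Tendsto (fun δ : ℝ => δ ^ N * volume.real (Metric.ball (0 : Space N) 1))
          (𝓝 0) (𝓝 (0 ^ N * volume.real (Metric.ball (0 : Space N) 1))) :=
          (continuous_id.pow N |>.mul continuous_const).tendsto 0
        rw [zero_pow (by omega), zero_mul] at this
        exact this.mono_left nhdsWithin_le_nhds
      refine hc.congr' ?_
      filter_upwards [self_mem_nhdsWithin] with δ hδ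
      have hδ' : (0 : ℝ) < δ := hδ
      rw [measureReal_def, measureReal_def, Measure.addHaar_ball_of_pos _ _ hδ',
        ENNReal.toReal_mul, finrank_euclideanSpace_fin, ENNReal.toReal_ofReal (by positivity)]
    exact this.eventually_lt_const (by simpa using ha)
  have hall := (eventually_all.2 hball).and ((eventually_all.2 fun i => eventually_all.2 fun j =>
    eventually_imp_distrib_left.2 (hdisj i j)).and (hvol.and self_mem_nhdsWithin))
  obtain ⟨δ, hb, hd, hv, hδ⟩ := hall.exists
  have hδ' : (0 : ℝ) < δ := hδ
  set w : ∀ i : Fin k, ContDiffBump (p i : Space N) := fun i => ⟨δ / 2, δ, by positivity, by linarith⟩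
    with hw
  have hsupp : ∀ i, Function.support (w i) = Metric.ball (p i : Space N) δ :=
    fun i => (w i).support_eq
  have htest : ∀ i, IsTestFunction Ω (w i) := fun i =>
    ⟨(w i).contDiff, (w i).hasCompactSupport, by rw [(w i).tsupport_eq]; exact hb i⟩
  refine ⟨fun i => w i, ⟨fun i => (htest i).hasH10Gradient.memH10 hfin, fun i h0 => ?_,
    fun i j hij => Eventually.of_forall fun x => ?_⟩, ?_⟩
  · rw [EventuallyEq, ae_iff, Measure.restrict_apply' hΩ.measurableSet] at h0
    have hset : {x | ¬ w i x = (0 : Space N → ℝ) x} ∩ Ω = Metric.ball (p i : Space N) δ := by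
      rw [← hsupp i]
      refine Set.inter_eq_left.2 fun x hx => hb i (Metric.ball_subset_closedBall ?_)
      rw [← hsupp i]
      exact hx
    rw [hset] at h0
    exact (Metric.measure_ball_pos volume (p i : Space N) hδ').ne' h0
  · by_contra hne
    have h1 : x ∈ Metric.ball (p i : Space N) δ := by
      rw [← hsupp i]; exact left_ne_zero_of_mul hne
    have h2 : x ∈ Metric.ball (p j : Space N) δ := by
      rw [← hsupp j]; exact right_ne_zero_of_mul hne
    exact Set.disjoint_left.1 (hd i j hij) h1 h2
  · refine le_trans (Finset.sum_le_sum fun i _ => measureReal_mono ?_ ?_) hv.le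
    · intro x hx
      rw [← hsupp i]
      exact hx.2
    · exact Metric.isBounded_ball.measure_lt_top.ne

/-- The competitor `w` does not depend on `η` and has nonpositive penalty, while every penalty is at
least `-η a ≥ -a`. -/
theorem exists_rayleigh_bound (hN : 1 ≤ N) (hΩ : IsOpen Ω) (hne : Ω.Nonempty)
    (hfin : volume Ω ≠ ⊤) (k : ℕ) {a : ℝ} (ha : 0 < a) :
    ∃ M : ℝ, ∀ η : ℝ, 0 < η → η ≤ 1 → ∀ u : Fin k → Space N → ℝ,
      IsNormalizedMinimizer Ω k a η u → ∀ i, rayleigh Ω (u i) ≤ M := by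
  obtain ⟨w, hw, hwa⟩ := exists_bump_admissible hN hΩ hne hfin k ha
  refine ⟨∑ i, rayleigh Ω (w i) + a, fun η hη hη1 u hu i => ?_⟩
  have hmin : functionalJ Ω k a η u ≤ functionalJ Ω k a η w := hu.2.1 hw
  have e : ∀ v : Fin k → Space N → ℝ, functionalJ Ω k a η v
      = ∑ i, rayleigh Ω (v i) + penalty a η (∑ i, volume.real (nodalSet Ω (v i))) := fun v => rfl
  rw [e, e] at hmin
  have hpa : penalty a η a = 0 := by simp [penalty]
  have h1 := penalty_sub_ge (a := a) hη hη1 hwa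
  have h3 : penalty a η 0 = -(η * a) := by simp [penalty, ha.not_ge]
  have h4 : rayleigh Ω (u i) ≤ ∑ j, rayleigh Ω (u j) :=
    Finset.single_le_sum (f := fun j => rayleigh Ω (u j)) (fun j _ => rayleigh_nonneg Ω (u j))
      (Finset.mem_univ i)
  have h5 : 0 ≤ ∑ j, volume.real (nodalSet Ω (u j)) :=
    Finset.sum_nonneg fun _ _ => measureReal_nonneg
  have h2 := penalty_sub_ge (a := a) hη hη1 h5
  have h6 : 0 ≤ η * (∑ j, volume.real (nodalSet Ω (u j)) - 0) := by rw [sub_zero]; positivity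
  have h7 : 0 ≤ η * (a - ∑ i, volume.real (nodalSet Ω (w i))) :=
    mul_nonneg hη.le (by linarith)
  have h8 : η * a ≤ a := mul_le_of_le_one_left ha.le hη1
  linarith

end SpectralPartition

end

theorem mainTheorem12 (N : ℕ) (hN : 1 ≤ N) (k : ℕ) (Ω : Set (SpectralPartition.Space N))
    (hΩ_open : IsOpen Ω) (hΩ_conn : IsConnected Ω) (hΩ_bdd : Bornology.IsBounded Ω)
    (a : ℝ) (ha : 0 < a) (haΩ : ENNReal.ofReal a < volume Ω) :
    ∃ C : ℝ, 0 < C ∧ ∀ η : ℝ, 0 < η → η ≤ 1 →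
      ∀ u : Fin k → SpectralPartition.Space N → ℝ,
        SpectralPartition.IsNormalizedMinimizer Ω k a η u →
        ∀ i : Fin k,
          SpectralPartition.HasFinitePerimeter (SpectralPartition.nodalSet Ω (u i)) ∧
          SpectralPartition.perimeter (SpectralPartition.nodalSet Ω (u i)) ≤
            ENNReal.ofReal (C * η ^ (-(1 / 2) : ℝ)) := by
  have hfin : volume Ω ≠ ⊤ := hΩ_bdd.measure_lt_top.ne
  obtain ⟨M, hM⟩ := SpectralPartition.exists_rayleigh_bound hN hΩ_open hΩ_conn.nonempty hfin k ha
  obtain ⟨K, hK, hper⟩ := SpectralPartition.perimeter_nodalSet_le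
  set A : ℝ := 4 * (volume.real Ω + 1) with hA
  have hApos : 0 < A := by positivity
  -- `|M| + 1` replaces `M` to make the constant positive.
  refine ⟨K * (3 / 2 * A * (|M| + 1)), by positivity, fun η hη hη1 u hu i => ?_⟩
  suffices hle : SpectralPartition.perimeter (SpectralPartition.nodalSet Ω (u i)) ≤
      ENNReal.ofReal (K * (3 / 2 * A * (|M| + 1)) * η ^ (-(1 / 2) : ℝ)) from
    ⟨hle.trans_lt ENNReal.ofReal_lt_top, hle⟩
  obtain ⟨G, hG⟩ := (hu.1.1 i).hasH10Gradient
  have hl : ∫ x in Ω, ‖G x‖ ^ 2 ≤ |M| + 1 := by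
    have h1 := hM η hη hη1 u hu i
    rw [hG.rayleigh_eq hΩ_open hfin, hu.2.2 i, div_one] at h1
    linarith [le_abs_self M]
  -- The threshold `δ = 1 / (2 A)` is exactly the condition `A t ≤ 1 / 2` of the layer estimate.
  refine (hper (B := 3 / 2 * A * (∫ x in Ω, ‖G x‖ ^ 2) / √η) (δ := 1 / (2 * A)) hfin hG
    (by positivity) fun t ht htδ => hu.layer_integral_le hΩ_open hfin hη hη1 i hG ht hA ?_).trans
    (ENNReal.ofReal_le_ofReal ?_)
  · rw [le_div_iff₀ (by positivity)] at htδ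
    linarith
  · rw [Real.rpow_neg hη.le, ← Real.sqrt_eq_rpow, ← div_eq_mul_inv,
      mul_div_assoc K]
    gcongr
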